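/- Let $\alpha>-1$. For $n\in\mathbb{Z}_+=\{0,1,2,\dots\}$ let $L_n^{\alpha}(x)=\binom{n+\alpha}{n}\,{}_1F_1(-n;\alpha+1;x)$ be the generalized Laguerre polynomials, and put $$\mathcal{L}_n(\alpha;x)=\frac{1}{\sqrt{\Gamma(\alpha+1)\binom{n+\alpha}{n}}}\,L_n^{\alpha}(-x).$$ For $c>0$ and $t_0\ge 0$ define the modified kernel polynomials $$L_n(\alpha,c,t_0;x)=\sum_{k=0}^n\frac{1}{k+c}\,\mathcal{L}_k(\alpha;t_0)\,\mathcal{L}_k(\alpha;x),\qquad n\in\mathbb{Z}_+,$$ and for $a,d\in\mathbb{R}$ let $D_{a,d}=x\frac{d^2}{dx^2}+(a+1+x)\frac{d}{dx}+d$. (i) For all $c>0$ and $t_0\ge 0$, the polynomials $L_n(x)=L_n(\alpha,c,t_0;x)$ have degree exactly $n$ and are Sobolev orthogonal: there are positive numbers $B_n$, $n\in\mathbb{Z}_+$, such that for all $n,m\in\mathbb{Z}_+$ the following integral converges absolutely and $$\int_{-\infty}^0 \bigl(L_n(x),L_n'(x),L_n''(x)\bigr)\,M_{\alpha,c}(x)\begin{pmatrix}L_m(x)\\L_m'(x)\\L_m''(x)\end{pmatrix}(t_0-x)(-x)^{\alpha}e^{x}\,dx=B_n\delta_{n,m},$$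 where $$M_{\alpha,c}(x)=\begin{pmatrix}c\\ \alpha+1+x\\ x\end{pmatrix}\bigl(c,\ \alpha+1+x,\ x\bigr).$$ (ii) For all $c>0$ and $n\in\mathbb{Z}_+$, $$D_{\alpha+1,0}D_{\alpha,c}L_n(\alpha,c,0;x)=n\,D_{\alpha,c}L_n(\alpha,c,0;x).$$ (iii) For every positive integer $c$, every $x<0$ and every $n\in\mathbb{Z}_+$, $$L_n(\alpha,c,0;x)=\frac{e^{-x}(-x)^{-\alpha/2}}{\Gamma(\alpha+1)\,n!}\int_0^\infty\!\int_0^t e^{-t}\,t^{\frac{\alpha}{2}-c}\,\theta^{\,n+c-1}J_\alpha\bigl(2\sqrt{-tx}\bigr)\,{}_2F_0\Bigl(-n,1;-;-\frac1\theta\Bigr)\,d\theta\,dt,$$ where $J_\alpha$ is the Bessel function of the first kind; the inner integral (for each $t>0$) and the outer integral converge absolutely. -/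

import Mathlib

open MeasureTheory

noncomputable section

namespace ModifiedKernel

open Polynomial

/-- The generalized hypergeometric series
`∑ k, (a₁)_k ⋯ (a_p)_k / ((b₁)_k ⋯ (b_q)_k) * x ^ k / k!`
with upper parameters `a` and lower parameters `b`. -/
def hypergeometric (a b : List ℝ) (x : ℝ) : ℝ :=
  ∑' k : ℕ, (a.map fun s => (ascPochhammer ℝ k).eval s).prod /
    (b.map fun s => (ascPochhammer ℝ k).eval s).prod * (x ^ k / (k.factorial : ℝ))

/-- The Bessel function of the first kind `J_ν`, for a real order `ν` and a positive argument. At the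
poles of `Γ` the convention `1 / 0 = 0` gives the usual value of `1 / Γ`. -/
def besselJ (ν z : ℝ) : ℝ :=
  ∑' k : ℕ, (-1) ^ k / ((k.factorial : ℝ) * Real.Gamma (k + ν + 1)) *
    (z / 2) ^ (2 * (k : ℝ) + ν)

/-- The generalized Laguerre polynomial `L_n^α = binom (n + α) n * ₁F₁(-n; α + 1; X)`, with the
terminating series written out. -/
def laguerre (α : ℝ) (n : ℕ) : ℝ[X] :=
  C (Ring.choose ((n : ℝ) + α) n) *
    ∑ k ∈ Finset.range (n + 1),
      C ((ascPochhammer ℝ k).eval (-(n : ℝ)) / (ascPochhammer ℝ k).eval (α + 1) /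
        (k.factorial : ℝ)) * X ^ k

theorem eval_laguerre (α : ℝ) (n : ℕ) (x : ℝ) :
    (laguerre α n).eval x =
      Ring.choose ((n : ℝ) + α) n * hypergeometric [-(n : ℝ)] [α + 1] x := by
  unfold laguerre hypergeometric
  rw [tsum_eq_sum (s := Finset.range (n + 1))]
  · simp only [eval_mul, eval_C, eval_finsetSum, eval_pow, eval_X, List.map_cons, List.map_nil,
      List.prod_cons, List.prod_nil, mul_one]
    congr 1
    refine Finset.sum_congr rfl fun k _ => ?_
    ring
  · intro k hk
    have h : n < k := by simpa [Nat.lt_succ_iff] using hk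
    simp [ascPochhammer_eval_neg_coe_nat_of_lt h]

/-- The polynomial `𝓛_n(α; x) = L_n^α(-x) / √(Γ(α + 1) * binom (n + α) n)`. -/
def normLaguerre (α : ℝ) (n : ℕ) : ℝ[X] :=
  C (1 / √(Real.Gamma (α + 1) * Ring.choose ((n : ℝ) + α) n)) * (laguerre α n).comp (-X)

/-- `λ_{n,c} = c + n`. -/
def lam (n : ℕ) (c : ℝ) : ℝ := c + n

/-- The modified kernel polynomial `L_n(α, c, t₀; x) = ∑_{k ≤ n} 𝓛_k(α; t₀) 𝓛_k(α; x) / λ_{k,c}`. -/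
def modKernel (α c t₀ : ℝ) (n : ℕ) : ℝ[X] :=
  ∑ k ∈ Finset.range (n + 1),
    C (1 / lam k c * (normLaguerre α k).eval t₀) * normLaguerre α k

/-- The differential operator `D_{α,c} = x d²/dx² + (α + 1 + x) d/dx + c`, on polynomials. -/
def diffOp (α c : ℝ) (P : ℝ[X]) : ℝ[X] :=
  X * derivative (derivative P) + (C (α + 1) + X) * derivative P + C c * P

/-- The vector `(P(x), P'(x), P''(x))`. -/
def jet (P : ℝ[X]) (x : ℝ) : Fin 3 → ℝ :=
  ![P.eval x, (derivative P).eval x, (derivative (derivative P)).eval x]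

/-- The matrix `M_{α,c}(x)`, product of the column `(c, α + 1 + x, x)ᵀ` and the row
`(c, α + 1 + x, x)`. -/
def sobolevMatrix (α c x : ℝ) : Matrix (Fin 3) (Fin 3) ℝ :=
  Matrix.vecMulVec ![c, α + 1 + x, x] ![c, α + 1 + x, x]

/-- The integrand `(P, P', P'') M_{α,c} (Q, Q', Q'')ᵀ (t₀ - x) (-x)^α e^x`. -/
def sobolevIntegrand (α c t₀ : ℝ) (P Q : ℝ[X]) (x : ℝ) : ℝ :=
  (jet P x ⬝ᵥ (sobolevMatrix α c x).mulVec (jet Q x)) * ((t₀ - x) * (-x) ^ α * Real.exp x)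

/-- The integrand of the double integral, as a function of `t` and `θ`. -/
def besselIntegrand (α : ℝ) (c n : ℕ) (x t θ : ℝ) : ℝ :=
  Real.exp (-t) * t ^ (α / 2 - c) * θ ^ ((n : ℝ) + c - 1) * besselJ α (2 * √(-(t * x))) *
    hypergeometric [-(n : ℝ), 1] [] (-1 / θ)

end ModifiedKernel

end

/-! The reflected polynomials `L_k^α(-x)` are eigenfunctions of `D_{α,c}` with eigenvalue `k + c`
(`diffOp_reflLaguerre`). Applied to the modified kernel, `D_{α,c}` cancels the weights `1/(k+c)` and
leaves the Christoffel–Darboux kernel `K_n` (`diffOp_modKernel`).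

(i) The matrix has rank one, so the Sobolev form is `∫ K_n K_m (t₀ - x) (-x)^α e^x dx`. For `m < n`
the factor `K_m (t₀ - x)` has degree at most `n` and vanishes at `t₀`, so the reproducing property
`momentFunctional_kernelPoly_mul` gives zero. For `m = n` the integrand is nonnegative.

(ii) At `t₀ = 0` the kernel is a multiple of `L_n^{α+1}(-x)` (`kernelPoly_zero`), an eigenfunction
of `D_{α+1,0}`.

(iii) At `t₀ = 0` the modified kernel is `∑ L_j^α(-x) / ((j+c) Γ(α+1))`. The Laplace-type integral
`integral_exp_mul_besselSeries` produces each `j! L_j^α(-x)`, integrating `θ^(j+c-1)` produces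
`1/(j+c)`, and the `₂F₀` factor packs these powers with weights `n!/j!`. -/

noncomputable section

namespace ModifiedKernel

open Polynomial

/-! ### Coefficients and positivity of reflected Laguerre polynomials -/

/-- The reflected Laguerre polynomial `L_n^α(-X)`. -/
def reflLaguerre (α : ℝ) (n : ℕ) : ℝ[X] := (laguerre α n).comp (-X)

theorem choose_natCast_add_eq (α : ℝ) (n : ℕ) :
    Ring.choose ((n : ℝ) + α) n = (ascPochhammer ℝ n).eval (α + 1) / (n.factorial : ℝ) := by
  have h := Ring.factorial_nsmul_multichoose_eq_ascPochhammer (α + 1) n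
  rw [ascPochhammer_smeval_eq_eval, nsmul_eq_mul] at h
  rw [Ring.choose, show (n : ℝ) + α - n + 1 = α + 1 by ring, ← h]
  have : (n.factorial : ℝ) ≠ 0 := by positivity
  field_simp

theorem ascPochhammer_eval_neg_natCast (n k : ℕ) :
    (ascPochhammer ℝ k).eval (-(n : ℝ)) = (-1) ^ k * (n.descFactorial k : ℝ) := by
  rw [ascPochhammer_eval_neg_eq_descPochhammer, descPochhammer_eval_eq_descFactorial]

theorem coeff_reflLaguerre (α : ℝ) (n j : ℕ) :
    (reflLaguerre α n).coeff j =
      (ascPochhammer ℝ n).eval (α + 1) / (ascPochhammer ℝ j).eval (α + 1) *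
        (n.choose j : ℝ) / (n.factorial : ℝ) := by
  rw [reflLaguerre, show (-X : ℝ[X]) = C (-1) * X by simp, comp_C_mul_X_coeff, laguerre, coeff_C_mul, finsetSum_coeff]
  simp only [coeff_C_mul, coeff_X_pow, mul_ite, mul_one, mul_zero]
  rw [Finset.sum_ite_eq, choose_natCast_add_eq]
  split_ifs with h
  · rw [ascPochhammer_eval_neg_natCast, Nat.descFactorial_eq_factorial_mul_choose]
    have h1 : (j.factorial : ℝ) ≠ 0 := by positivity
    have h2 : ((-1 : ℝ) ^ j) * (-1) ^ j = 1 := by rw [← mul_pow]; simp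
    push_cast
    calc _ = ((-1 : ℝ) ^ j * (-1) ^ j) * ((ascPochhammer ℝ n).eval (α + 1) / n.factorial *
          (j.factorial * n.choose j / (ascPochhammer ℝ j).eval (α + 1) / j.factorial)) := by ring
      _ = _ := by rw [h2]; field_simp
  · rw [Nat.choose_eq_zero_of_lt (by simpa [Nat.lt_succ_iff] using h)]
    simp

theorem ascPochhammer_eval_pos {α : ℝ} (hα : -1 < α) (n : ℕ) :
    0 < (ascPochhammer ℝ n).eval (α + 1) :=
  ascPochhammer_pos n _ (by linarith)

theorem natDegree_reflLaguerre_le (α : ℝ) (n : ℕ) : (reflLaguerre α n).natDegree ≤ n := by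
  refine natDegree_le_iff_coeff_eq_zero.2 fun j hj => ?_
  rw [coeff_reflLaguerre, Nat.choose_eq_zero_of_lt hj]
  simp

theorem coeff_reflLaguerre_self {α : ℝ} (hα : -1 < α) (n : ℕ) :
    (reflLaguerre α n).coeff n = 1 / (n.factorial : ℝ) := by
  rw [coeff_reflLaguerre, div_self (ascPochhammer_eval_pos hα n).ne', Nat.choose_self]
  simp

theorem coeff_reflLaguerre_nonneg {α : ℝ} (hα : -1 < α) (n j : ℕ) :
    0 ≤ (reflLaguerre α n).coeff j := by
  rw [coeff_reflLaguerre]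
  have h1 := ascPochhammer_eval_pos hα n
  have h2 := ascPochhammer_eval_pos hα j
  positivity

theorem coeff_zero_reflLaguerre (α : ℝ) (n : ℕ) :
    (reflLaguerre α n).coeff 0 = Ring.choose ((n : ℝ) + α) n := by
  rw [coeff_reflLaguerre, choose_natCast_add_eq]
  simp

theorem choose_natCast_add_pos {α : ℝ} (hα : -1 < α) (n : ℕ) :
    0 < Ring.choose ((n : ℝ) + α) n := by
  rw [choose_natCast_add_eq]
  have := ascPochhammer_eval_pos hα n
  positivity

theorem eval_reflLaguerre_pos {α : ℝ} (hα : -1 < α) (n : ℕ) {t : ℝ} (ht : 0 ≤ t) :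
    0 < (reflLaguerre α n).eval t := by
  rw [eval_eq_sum_range, Finset.sum_range_succ']
  refine add_pos_of_nonneg_of_pos (Finset.sum_nonneg fun j _ => ?_) ?_
  · exact mul_nonneg (coeff_reflLaguerre_nonneg hα n _) (pow_nonneg ht _)
  · simpa [coeff_zero_reflLaguerre] using choose_natCast_add_pos hα n

/-! ### The differential operator and its eigenfunctions -/

theorem coeff_diffOp (α c : ℝ) (P : ℝ[X]) (j : ℕ) :
    (diffOp α c P).coeff j =
      (j + 1) * (α + 1 + j) * P.coeff (j + 1) + (j + c) * P.coeff j := by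
  rw [diffOp, add_mul]
  cases j with
  | zero => simp [coeff_derivative]
  | succ j =>
    simp only [coeff_add, coeff_X_mul, coeff_C_mul, coeff_derivative]
    push_cast
    ring

/-- Comparing coefficients reduces this to `(j+1) * choose n (j+1) = (n-j) * choose n j`. -/
theorem diffOp_reflLaguerre {α : ℝ} (hα : -1 < α) (c : ℝ) (n : ℕ) :
    diffOp α c (reflLaguerre α n) = C (lam n c) * reflLaguerre α n := by
  ext j
  rw [coeff_diffOp, coeff_C_mul, coeff_reflLaguerre, coeff_reflLaguerre, lam,
    ascPochhammer_succ_eval]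
  have h1 := (ascPochhammer_eval_pos hα j).ne'
  have h2 : α + 1 + j ≠ 0 := by
    have : (0 : ℝ) ≤ j := by positivity
    linarith
  have h3 : ((n.choose (j + 1) : ℕ) : ℝ) * (j + 1) = n.choose j * (n - j) := by
    rcases le_or_gt j n with h | h
    · have := Nat.choose_succ_right_eq n j
      rw [← Nat.cast_sub h]
      exact_mod_cast this
    · rw [Nat.choose_eq_zero_of_lt h, Nat.choose_eq_zero_of_lt (by lia)]
      simp
  field_simp
  linear_combination (ascPochhammer ℝ n).eval (α + 1) * h3

theorem diffOp_add (α c : ℝ) (P Q : ℝ[X]) :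
    diffOp α c (P + Q) = diffOp α c P + diffOp α c Q := by
  simp only [diffOp, derivative_add]
  ring

theorem diffOp_C_mul (α c r : ℝ) (P : ℝ[X]) :
    diffOp α c (C r * P) = C r * diffOp α c P := by
  simp only [diffOp, derivative_C_mul]
  ring

theorem diffOp_sum (α c : ℝ) {ι : Type*} (s : Finset ι) (P : ι → ℝ[X]) :
    diffOp α c (∑ i ∈ s, P i) = ∑ i ∈ s, diffOp α c (P i) := by
  classical
  induction s using Finset.induction_on with
  | empty => simp [diffOp]
  | insert i s hi ih => rw [Finset.sum_insert hi, Finset.sum_insert hi, diffOp_add, ih]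

theorem normLaguerre_eq (α : ℝ) (n : ℕ) :
    normLaguerre α n =
      C (1 / √(Real.Gamma (α + 1) * Ring.choose ((n : ℝ) + α) n)) * reflLaguerre α n := rfl

theorem gamma_mul_choose_pos {α : ℝ} (hα : -1 < α) (n : ℕ) :
    0 < Real.Gamma (α + 1) * Ring.choose ((n : ℝ) + α) n :=
  mul_pos (Real.Gamma_pos_of_pos (by linarith)) (choose_natCast_add_pos hα n)

theorem diffOp_normLaguerre {α : ℝ} (hα : -1 < α) (c : ℝ) (n : ℕ) :
    diffOp α c (normLaguerre α n) = C (lam n c) * normLaguerre α n := by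
  rw [normLaguerre_eq, diffOp_C_mul, diffOp_reflLaguerre hα]
  ring

/-! ### Kernel polynomials and the case `t₀ = 0` -/

/-- The Christoffel–Darboux kernel `∑_{k ≤ n} 𝓛_k(α; t₀) 𝓛_k(α; x)`. -/
def kernelPoly (α t₀ : ℝ) (n : ℕ) : ℝ[X] :=
  ∑ k ∈ Finset.range (n + 1), C ((normLaguerre α k).eval t₀) * normLaguerre α k

theorem lam_pos {c : ℝ} (hc : 0 < c) (n : ℕ) : 0 < lam n c := by
  unfold lam
  positivity

theorem diffOp_modKernel {α c : ℝ} (hα : -1 < α) (hc : 0 < c) (t₀ : ℝ) (n : ℕ) :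
    diffOp α c (modKernel α c t₀ n) = kernelPoly α t₀ n := by
  rw [modKernel, kernelPoly, diffOp_sum]
  refine Finset.sum_congr rfl fun k _ => ?_
  rw [diffOp_C_mul, diffOp_normLaguerre hα, ← mul_assoc, ← C_mul]
  congr 2
  have := (lam_pos hc k).ne'
  field_simp

theorem sum_reflLaguerre {α : ℝ} (hα : -1 < α) (n : ℕ) :
    ∑ k ∈ Finset.range (n + 1), reflLaguerre α k = reflLaguerre (α + 1) n := by
  induction n with
  | zero =>
    ext j
    cases j <;> simp [coeff_reflLaguerre]
  | succ n ih =>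
    rw [Finset.sum_range_succ, ih]
    ext j
    rw [coeff_add]
    simp only [coeff_reflLaguerre]
    have shift : ∀ m : ℕ, (ascPochhammer ℝ m).eval (α + 1 + 1) =
        (ascPochhammer ℝ m).eval (α + 1) * (α + 1 + m) / (α + 1) := fun m => by
      have h0 : α + 1 ≠ 0 := by linarith
      rw [eq_div_iff h0, ← ascPochhammer_succ_eval, ascPochhammer_succ_left]
      simp [mul_comm]
    rw [shift, shift, shift, ascPochhammer_succ_eval, Nat.factorial_succ]
    have h1 := (ascPochhammer_eval_pos hα j).ne'
    have hj : α + 1 + (j : ℝ) ≠ 0 := by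
      have : (0 : ℝ) ≤ j := by positivity
      linarith
    have h0 : α + 1 ≠ 0 := by linarith
    have h3 : ((n.choose j : ℕ) : ℝ) * (n + 1) = (n + 1).choose j * (n + 1 - j) := by
      rcases le_or_gt j (n + 1) with h | h
      · have := Nat.choose_mul_succ_eq n j
        rw [show (n : ℝ) + 1 - j = ((n + 1 - j : ℕ) : ℝ) by rw [Nat.cast_sub h]; simp]
        exact_mod_cast this
      · rw [Nat.choose_eq_zero_of_lt h, Nat.choose_eq_zero_of_lt (by lia)]
        simp
    have hf : (n.factorial : ℝ) ≠ 0 := by positivity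
    push_cast
    have hn : (n : ℝ) + 1 ≠ 0 := by positivity
    field_simp
    linear_combination (ascPochhammer ℝ n).eval (α + 1) * (α + 1 + n) * h3

/-- The value at `0` is the binomial over the normalizing root, so the product has the same factor
`1/Γ(α+1)` for every `n`. This makes the kernel at `0` a plain sum of Laguerre polynomials. -/
theorem eval_normLaguerre_zero_mul {α : ℝ} (hα : -1 < α) (n : ℕ) :
    C ((normLaguerre α n).eval 0) * normLaguerre α n =
      C (1 / Real.Gamma (α + 1)) * reflLaguerre α n := by
  rw [normLaguerre_eq, ← mul_assoc, ← C_mul]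
  congr 2
  rw [eval_mul, eval_C, ← coeff_zero_eq_eval_zero, coeff_zero_reflLaguerre]
  have h1 := choose_natCast_add_pos hα n
  have h2 : 0 < Real.Gamma (α + 1) := Real.Gamma_pos_of_pos (by linarith)
  have h3 := Real.mul_self_sqrt (gamma_mul_choose_pos hα n).le
  have h4 := Real.sqrt_pos.2 (gamma_mul_choose_pos hα n)
  generalize √(Real.Gamma (α + 1) * Ring.choose ((n : ℝ) + α) n) = s at *
  field_simp
  linear_combination -h3

theorem kernelPoly_zero {α : ℝ} (hα : -1 < α) (n : ℕ) :
    kernelPoly α 0 n = C (1 / Real.Gamma (α + 1)) * reflLaguerre (α + 1) n := by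
  rw [kernelPoly, ← sum_reflLaguerre hα, Finset.mul_sum]
  exact Finset.sum_congr rfl fun k _ => eval_normLaguerre_zero_mul hα k

theorem diffOp_diffOp_modKernel {α c : ℝ} (hα : -1 < α) (hc : 0 < c) (n : ℕ) :
    diffOp (α + 1) 0 (diffOp α c (modKernel α c 0 n)) =
      lam n 0 • diffOp α c (modKernel α c 0 n) := by
  rw [diffOp_modKernel hα hc, kernelPoly_zero hα, diffOp_C_mul,
    diffOp_reflLaguerre (by linarith : -1 < α + 1), smul_eq_C_mul]
  ring

/-! ### Degrees -/

theorem natDegree_normLaguerre_le (α : ℝ) (n : ℕ) : (normLaguerre α n).natDegree ≤ n :=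
  (natDegree_C_mul_le _ _).trans (natDegree_reflLaguerre_le α n)

theorem coeff_normLaguerre_self_pos {α : ℝ} (hα : -1 < α) (n : ℕ) :
    0 < (normLaguerre α n).coeff n := by
  rw [normLaguerre_eq, coeff_C_mul, coeff_reflLaguerre_self hα]
  have := Real.sqrt_pos.2 (gamma_mul_choose_pos hα n)
  positivity

theorem eval_normLaguerre_pos {α : ℝ} (hα : -1 < α) (n : ℕ) {t : ℝ} (ht : 0 ≤ t) :
    0 < (normLaguerre α n).eval t := by
  rw [normLaguerre_eq, eval_mul, eval_C]
  have := Real.sqrt_pos.2 (gamma_mul_choose_pos hα n)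
  have := eval_reflLaguerre_pos hα n ht
  positivity

/-- A combination of `𝓛_0, …, 𝓛_n` with a nonzero last weight has degree `n`. -/
theorem degree_sum_normLaguerre {α : ℝ} (hα : -1 < α) (w : ℕ → ℝ) (n : ℕ) (hw : w n ≠ 0) :
    (∑ k ∈ Finset.range (n + 1), C (w k) * normLaguerre α k).degree = n := by
  refine degree_eq_of_le_of_coeff_ne_zero ?_ ?_
  · refine degree_le_of_natDegree_le (natDegree_sum_le_of_forall_le _ _ fun k hk => ?_)
    refine (natDegree_C_mul_le _ _).trans ((natDegree_normLaguerre_le α k).trans ?_)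
    exact Nat.lt_succ_iff.1 (Finset.mem_range.1 hk)
  · rw [finsetSum_coeff, Finset.sum_range_succ, Finset.sum_eq_zero, zero_add, coeff_C_mul]
    · exact mul_ne_zero hw (coeff_normLaguerre_self_pos hα n).ne'
    · intro k hk
      rw [coeff_C_mul, coeff_eq_zero_of_natDegree_lt
        ((natDegree_normLaguerre_le α k).trans_lt (Finset.mem_range.1 hk)), mul_zero]

theorem degree_modKernel {α c t₀ : ℝ} (hα : -1 < α) (hc : 0 < c) (ht : 0 ≤ t₀) (n : ℕ) :
    (modKernel α c t₀ n).degree = n := by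
  refine degree_sum_normLaguerre hα (fun k => 1 / lam k c * (normLaguerre α k).eval t₀) n ?_
  have := lam_pos hc n
  have := eval_normLaguerre_pos hα n ht
  positivity

theorem degree_kernelPoly {α t₀ : ℝ} (hα : -1 < α) (ht : 0 ≤ t₀) (n : ℕ) :
    (kernelPoly α t₀ n).degree = n :=
  degree_sum_normLaguerre hα _ n (eval_normLaguerre_pos hα n ht).ne'

/-! ### Moments, orthonormality and the reproducing property -/

theorem integrableOn_pow_mul_laguerreWeight {α : ℝ} (hα : -1 < α) (k : ℕ) :
    IntegrableOn (fun x : ℝ => x ^ k * ((-x) ^ α * Real.exp x)) (Set.Iic 0) ∧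
      ∫ x in Set.Iic (0 : ℝ), x ^ k * ((-x) ^ α * Real.exp x) =
        (-1) ^ k * Real.Gamma (α + 1 + k) := by
  have hpos : 0 < α + 1 + k := by
    have : (0 : ℝ) ≤ k := by positivity
    linarith
  have key : Set.EqOn (fun y : ℝ => (-1 : ℝ) ^ k * (Real.exp (-y) * y ^ (α + 1 + k - 1)))
      (fun y : ℝ => (-y) ^ k * ((- -y) ^ α * Real.exp (-y))) (Set.Ioi 0) := fun y hy => by
    have hy' : (0 : ℝ) < y := hy
    simp only [neg_neg]
    rw [show α + 1 + k - 1 = α + k by ring, Real.rpow_add hy', Real.rpow_natCast, neg_pow y]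
    ring
  constructor
  · have h := IntegrableOn.congr_fun
      ((Real.GammaIntegral_convergent hpos).const_mul ((-1 : ℝ) ^ k)) key measurableSet_Ioi
    rw [integrableOn_Iic_iff_integrableOn_Iio]
    have h2 := IntegrableOn.comp_neg_Iio (c := (0 : ℝ)) (by simpa using h)
    simpa using h2
  · have h := integral_comp_neg_Ioi (0 : ℝ) fun x : ℝ => x ^ k * ((-x) ^ α * Real.exp x)
    rw [neg_zero] at h
    rw [← h, ← setIntegral_congr_fun measurableSet_Ioi key, integral_const_mul,
      Real.Gamma_eq_integral hpos]

theorem integrableOn_eval_mul_laguerreWeight {α : ℝ} (hα : -1 < α) (P : ℝ[X]) :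
    IntegrableOn (fun x : ℝ => P.eval x * ((-x) ^ α * Real.exp x)) (Set.Iic 0) := by
  simp only [eval_eq_sum_range, Finset.sum_mul, mul_assoc]
  exact integrable_finsetSum _ fun k _ =>
    (integrableOn_pow_mul_laguerreWeight hα k).1.const_mul _

/-- The moment functional `P ↦ ∫_{-∞}^0 P(x) (-x)^α e^x dx`. -/
def momentFunctional (α : ℝ) (hα : -1 < α) : ℝ[X] →ₗ[ℝ] ℝ where
  toFun P := ∫ x in Set.Iic (0 : ℝ), P.eval x * ((-x) ^ α * Real.exp x)
  map_add' P Q := by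
    simp only [eval_add, add_mul]
    exact integral_add (integrableOn_eval_mul_laguerreWeight hα P)
      (integrableOn_eval_mul_laguerreWeight hα Q)
  map_smul' r P := by
    simp only [eval_smul, smul_eq_mul, mul_assoc, RingHom.id_apply]
    exact integral_const_mul _ _

theorem momentFunctional_apply {α : ℝ} (hα : -1 < α) (P : ℝ[X]) :
    momentFunctional α hα P = ∫ x in Set.Iic (0 : ℝ), P.eval x * ((-x) ^ α * Real.exp x) := rfl

theorem momentFunctional_C_mul {α : ℝ} (hα : -1 < α) (r : ℝ) (P : ℝ[X]) :
    momentFunctional α hα (C r * P) = r * momentFunctional α hα P := by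
  rw [← smul_eq_C_mul, map_smul, smul_eq_mul]

theorem gamma_add_natCast {s : ℝ} (hs : 0 < s) (k : ℕ) :
    Real.Gamma (s + k) = (ascPochhammer ℝ k).eval s * Real.Gamma s := by
  induction k with
  | zero => simp
  | succ k ih =>
    have : s + k ≠ 0 := by positivity
    rw [Nat.cast_succ, ← add_assoc, Real.Gamma_add_one this, ih, ascPochhammer_succ_eval]
    ring

theorem ascPochhammer_eval_add_index (s : ℝ) (j k : ℕ) :
    (ascPochhammer ℝ (j + k)).eval s =
      (ascPochhammer ℝ j).eval s * (ascPochhammer ℝ k).eval (s + j) := by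
  rw [← ascPochhammer_mul]
  simp

theorem momentFunctional_X_pow {α : ℝ} (hα : -1 < α) (k : ℕ) :
    momentFunctional α hα (X ^ k) =
      (-1) ^ k * ((ascPochhammer ℝ k).eval (α + 1) * Real.Gamma (α + 1)) := by
  rw [momentFunctional_apply, ← gamma_add_natCast (by linarith : 0 < α + 1)]
  simpa using (integrableOn_pow_mul_laguerreWeight hα k).2

/-- Since `(α+1)_{j+k} = (α+1)_j (α+1+j)_k`, the denominators of the coefficients cancel. What
remains is an alternating binomial sum, the `n`-th difference of `s ↦ (s)_k`: zero for `k < n`, and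
`n!` for `k = n`. -/
theorem momentFunctional_reflLaguerre_mul_X_pow {α : ℝ} (hα : -1 < α) (n k : ℕ) :
    momentFunctional α hα (reflLaguerre α n * X ^ k) =
      (-1) ^ k * (-1) ^ n * Real.Gamma (α + 1) * (ascPochhammer ℝ n).eval (α + 1) /
        (n.factorial : ℝ) * ((fwdDiff 1)^[n] (ascPochhammer ℝ k).eval (α + 1)) := by
  rw [as_sum_range_C_mul_X_pow' (reflLaguerre α n)
    (Nat.lt_succ_of_le (natDegree_reflLaguerre_le α n)), Finset.sum_mul, map_sum,
    fwdDiff_iter_eq_sum_shift, Finset.mul_sum]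
  refine Finset.sum_congr rfl fun j hj => ?_
  have hj' : j ≤ n := Nat.lt_succ_iff.1 (Finset.mem_range.1 hj)
  rw [mul_assoc, ← pow_add, momentFunctional_C_mul, momentFunctional_X_pow,
    ascPochhammer_eval_add_index, coeff_reflLaguerre]
  have h1 := (ascPochhammer_eval_pos hα j).ne'
  have h2 : (-1 : ℝ) ^ n * (-1) ^ (n - j) = (-1) ^ j := by
    rw [← pow_add, show n + (n - j) = 2 * (n - j) + j by lia, pow_add, pow_mul]
    simp
  simp only [zsmul_eq_mul, nsmul_eq_mul, mul_one]
  push_cast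
  rw [pow_add, ← h2]
  field_simp

theorem momentFunctional_reflLaguerre_mul {α : ℝ} (hα : -1 < α) {n : ℕ} {q : ℝ[X]}
    (hq : q.natDegree ≤ n) :
    momentFunctional α hα (reflLaguerre α n * q) =
      q.coeff n * (Real.Gamma (α + 1) * (ascPochhammer ℝ n).eval (α + 1)) := by
  rw [as_sum_range_C_mul_X_pow' q (Nat.lt_succ_of_le hq), Finset.mul_sum, map_sum,
    Finset.sum_range_succ, Finset.sum_eq_zero, zero_add, ← as_sum_range_C_mul_X_pow' q
    (Nat.lt_succ_of_le hq)]
  · rw [mul_left_comm, momentFunctional_C_mul, momentFunctional_reflLaguerre_mul_X_pow]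
    have h := Polynomial.fwdDiff_iter_degree_eq_factorial (ascPochhammer ℝ n)
    rw [ascPochhammer_natDegree, (monic_ascPochhammer ℝ n).leadingCoeff, one_smul] at h
    rw [h, ← mul_pow]
    have : (n.factorial : ℝ) ≠ 0 := by positivity
    simp only [mul_neg, mul_one, neg_neg, one_pow, Pi.natCast_apply]
    field_simp
  · intro k hk
    rw [mul_left_comm, momentFunctional_C_mul, momentFunctional_reflLaguerre_mul_X_pow,
      Polynomial.fwdDiff_iter_eq_zero_of_degree_lt]
    · simp
    · rw [ascPochhammer_natDegree]
      exact Finset.mem_range.1 hk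

theorem momentFunctional_normLaguerre_mul {α : ℝ} (hα : -1 < α) {n : ℕ} {q : ℝ[X]}
    (hq : q.natDegree ≤ n) :
    momentFunctional α hα (normLaguerre α n * q) = q.coeff n / (normLaguerre α n).coeff n := by
  rw [normLaguerre_eq, mul_assoc, momentFunctional_C_mul, momentFunctional_reflLaguerre_mul hα hq,
    coeff_C_mul, coeff_reflLaguerre_self hα]
  have h3 := Real.mul_self_sqrt (gamma_mul_choose_pos hα n).le
  have h4 := (Real.sqrt_pos.2 (gamma_mul_choose_pos hα n)).ne'
  have h5 : (n.factorial : ℝ) ≠ 0 := by positivity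
  have h6 : Real.Gamma (α + 1) * (ascPochhammer ℝ n).eval (α + 1) =
      n.factorial * (Real.Gamma (α + 1) * Ring.choose ((n : ℝ) + α) n) := by
    rw [choose_natCast_add_eq]
    field_simp
  rw [h6]
  nth_rewrite 2 [← h3]
  field_simp

theorem natDegree_kernelPoly_le (α t₀ : ℝ) (n : ℕ) : (kernelPoly α t₀ n).natDegree ≤ n :=
  natDegree_sum_le_of_forall_le _ _ fun k hk =>
    (natDegree_C_mul_le _ _).trans ((natDegree_normLaguerre_le α k).trans
      (Nat.lt_succ_iff.1 (Finset.mem_range.1 hk)))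

/-- The reproducing property of the kernel polynomials. -/
theorem momentFunctional_kernelPoly_mul {α : ℝ} (hα : -1 < α) (t₀ : ℝ) {n : ℕ} {r : ℝ[X]}
    (hr : r.natDegree ≤ n) :
    momentFunctional α hα (kernelPoly α t₀ n * r) = r.eval t₀ := by
  induction n generalizing r with
  | zero =>
    have hl := (coeff_normLaguerre_self_pos hα 0).ne'
    have hd := eq_C_of_natDegree_eq_zero (Nat.le_zero.1 (natDegree_normLaguerre_le α 0))
    rw [kernelPoly, Finset.sum_range_one, mul_assoc, momentFunctional_C_mul,
      momentFunctional_normLaguerre_mul hα hr, eq_C_of_natDegree_eq_zero (Nat.le_zero.1 hr), hd]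
    simp only [eval_C, coeff_C_zero]
    field_simp
  | succ n ih =>
    have hl := (coeff_normLaguerre_self_pos hα (n + 1)).ne'
    -- `b` cancels the leading term, so that the induction hypothesis applies to the remainder.
    obtain ⟨b, hb⟩ : ∃ b, b = r.coeff (n + 1) / (normLaguerre α (n + 1)).coeff (n + 1) := ⟨_, rfl⟩
    have hs : (r - C b * normLaguerre α (n + 1)).natDegree ≤ n := by
      refine natDegree_le_iff_coeff_eq_zero.2 fun j hj => ?_
      rw [coeff_sub, coeff_C_mul]
      rcases (Nat.succ_le_of_lt hj).eq_or_lt with rfl | hj'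
      · rw [hb]
        field_simp
        simp
      · rw [coeff_eq_zero_of_natDegree_lt (hr.trans_lt hj'),
          coeff_eq_zero_of_natDegree_lt ((natDegree_normLaguerre_le α _).trans_lt hj')]
        simp
    have h1 := ih hs
    have h2 := momentFunctional_normLaguerre_mul hα hr
    have h3 := momentFunctional_normLaguerre_mul hα (n := n + 1)
      ((natDegree_kernelPoly_le α t₀ n).trans n.le_succ)
    rw [coeff_eq_zero_of_natDegree_lt (Nat.lt_succ_of_le (natDegree_kernelPoly_le α t₀ n)),
      zero_div] at h3
    have hK : kernelPoly α t₀ (n + 1) * r =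
        kernelPoly α t₀ n * (r - C b * normLaguerre α (n + 1)) +
          C b * (normLaguerre α (n + 1) * kernelPoly α t₀ n) +
          C ((normLaguerre α (n + 1)).eval t₀) * (normLaguerre α (n + 1) * r) := by
      rw [kernelPoly, Finset.sum_range_succ, ← kernelPoly]
      ring
    rw [hK, map_add, map_add, momentFunctional_C_mul, momentFunctional_C_mul, h1, h2, h3, ← hb]
    simp only [eval_sub, eval_mul, eval_C]
    ring

/-! ### Sobolev orthogonality -/

theorem sobolevIntegrand_eq (α c t₀ : ℝ) (P Q : ℝ[X]) (x : ℝ) :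
    sobolevIntegrand α c t₀ P Q x =
      (diffOp α c P * (diffOp α c Q * (C t₀ - X))).eval x * ((-x) ^ α * Real.exp x) := by
  simp only [sobolevIntegrand, sobolevMatrix, jet, diffOp, Matrix.vecMulVec, Matrix.mulVec,
    dotProduct, Matrix.of_apply, Fin.sum_univ_three, Matrix.cons_val_zero, Matrix.cons_val_one,
    Matrix.cons_val, eval_mul, eval_add, eval_sub, eval_X, eval_C]
  ring

theorem integrableOn_sobolevIntegrand {α : ℝ} (hα : -1 < α) (c t₀ : ℝ) (P Q : ℝ[X]) :
    IntegrableOn (sobolevIntegrand α c t₀ P Q) (Set.Iic 0) := by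
  rw [funext (sobolevIntegrand_eq α c t₀ P Q)]
  exact integrableOn_eval_mul_laguerreWeight hα _

theorem integral_sobolevIntegrand {α : ℝ} (hα : -1 < α) (c t₀ : ℝ) (P Q : ℝ[X]) :
    ∫ x in Set.Iic (0 : ℝ), sobolevIntegrand α c t₀ P Q x =
      momentFunctional α hα (diffOp α c P * (diffOp α c Q * (C t₀ - X))) := by
  rw [momentFunctional_apply]
  simp only [sobolevIntegrand_eq]

theorem momentFunctional_kernelPoly_mul_kernelPoly_of_lt {α : ℝ} (hα : -1 < α) (t₀ : ℝ) {n m : ℕ}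
    (h : m < n) :
    momentFunctional α hα (kernelPoly α t₀ n * (kernelPoly α t₀ m * (C t₀ - X))) = 0 := by
  rw [momentFunctional_kernelPoly_mul]
  · simp
  · refine (natDegree_mul_le_of_le (natDegree_kernelPoly_le α t₀ m) (n := 1) ?_).trans h
    compute_degree

theorem momentFunctional_sq_mul_pos {α t₀ : ℝ} (hα : -1 < α) (ht : 0 ≤ t₀) {P : ℝ[X]}
    (hP : P ≠ 0) : 0 < momentFunctional α hα (P * (P * (C t₀ - X))) := by
  have e : ∀ x : ℝ, (P * (P * (C t₀ - X))).eval x * ((-x) ^ α * Real.exp x) =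
      P.eval x ^ 2 * ((t₀ - x) * ((-x) ^ α * Real.exp x)) := fun x => by
    simp only [eval_mul, eval_sub, eval_X, eval_C]
    ring
  rw [momentFunctional_apply, setIntegral_pos_iff_support_of_nonneg_ae]
  -- Off the finitely many roots of `P`, the integrand is positive on `(-1, 0)`, a set of positive
  -- measure.
  · have hsub : Set.Ioo (-1 : ℝ) 0 \ (P.roots.toFinset : Set ℝ) ⊆
        (Function.support fun x : ℝ => (P * (P * (C t₀ - X))).eval x * ((-x) ^ α * Real.exp x)) ∩
          Set.Iic 0 := by
      rintro x ⟨⟨_, hx⟩, hr⟩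
      refine ⟨?_, hx.le⟩
      have h0 : P.eval x ≠ 0 := fun h => hr (by simpa [hP] using h)
      have h1 : 0 < t₀ - x := by linarith
      have h2 : 0 < (-x) ^ α := Real.rpow_pos_of_pos (by linarith) _
      rw [Function.mem_support, e]
      positivity
    refine lt_of_lt_of_le ?_ (measure_mono hsub)
    rw [measure_sdiff_null (Finset.measure_zero _ _)]
    simp
  · filter_upwards [self_mem_ae_restrict (measurableSet_Iic (a := (0 : ℝ)))] with x hx
    have hx' : x ≤ 0 := hx
    have h1 : 0 ≤ t₀ - x := by linarith
    have h2 : 0 ≤ (-x) ^ α := Real.rpow_nonneg (by linarith) _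
    rw [Pi.zero_apply, e]
    positivity
  · exact integrableOn_eval_mul_laguerreWeight hα _

theorem sobolev_orthogonality {α c t₀ : ℝ} (hα : -1 < α) (hc : 0 < c) (ht : 0 ≤ t₀) :
    ∃ B : ℕ → ℝ, (∀ n, 0 < B n) ∧ ∀ n m : ℕ,
      IntegrableOn (sobolevIntegrand α c t₀ (modKernel α c t₀ n) (modKernel α c t₀ m))
        (Set.Iic 0) ∧
      ∫ x in Set.Iic (0 : ℝ),
        sobolevIntegrand α c t₀ (modKernel α c t₀ n) (modKernel α c t₀ m) x =
          if n = m then B n else 0 := by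
  refine ⟨fun n => momentFunctional α hα (kernelPoly α t₀ n * (kernelPoly α t₀ n * (C t₀ - X))),
    fun n => momentFunctional_sq_mul_pos hα ht fun h => ?_,
    fun n m => ⟨integrableOn_sobolevIntegrand hα _ _ _ _, ?_⟩⟩
  · have := degree_kernelPoly hα ht n
    rw [h, degree_zero] at this
    exact absurd this (by simp)
  · rw [integral_sobolevIntegrand hα, diffOp_modKernel hα hc, diffOp_modKernel hα hc]
    split_ifs with h
    · rw [h]
    · rcases lt_or_gt_of_ne h with h' | h'
      · rw [mul_left_comm]
        exact momentFunctional_kernelPoly_mul_kernelPoly_of_lt hα t₀ h'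
      · exact momentFunctional_kernelPoly_mul_kernelPoly_of_lt hα t₀ h'

/-! ### The Bessel series and its Laplace-type integral -/

/-- A Chu–Vandermonde expansion of `(s + k)_j` in the falling factorials of `k`. -/
theorem ascPochhammer_eval_add_natCast {s : ℝ} (hs : 0 < s) (j k : ℕ) :
    (ascPochhammer ℝ j).eval (s + k) =
      ∑ i ∈ Finset.range (j + 1), (j.choose i : ℝ) *
        ((ascPochhammer ℝ j).eval s / (ascPochhammer ℝ i).eval s) * (k.descFactorial i : ℝ) := by
  induction j with
  | zero => simp
  | succ j ih =>
    have hd : ∀ i : ℕ, (k.descFactorial (i + 1) : ℝ) = (k - i) * k.descFactorial i := fun i => by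
      rw [Nat.descFactorial_succ]
      rcases le_or_gt i k with h | h
      · rw [Nat.cast_mul, Nat.cast_sub h]
      · rw [Nat.descFactorial_of_lt h]
        simp
    have hp : ∀ i : ℕ, (ascPochhammer ℝ i).eval s ≠ 0 := fun i => (ascPochhammer_pos i s hs).ne'
    obtain ⟨A, hA⟩ : ∃ A : ℕ → ℝ, A = fun i => (j.choose i : ℝ) *
        ((ascPochhammer ℝ j).eval s / (ascPochhammer ℝ i).eval s) := ⟨_, rfl⟩
    -- The new factor `s + k + j` splits as `(k - i) + (s + i + j)`: the first part raises the
    -- falling factorial, the second keeps it.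
    have hL : (ascPochhammer ℝ (j + 1)).eval (s + k) =
        ∑ i ∈ Finset.range (j + 1), A i * k.descFactorial (i + 1) +
          ∑ i ∈ Finset.range (j + 2), A i * (s + i + j) * k.descFactorial i := by
      rw [Finset.sum_range_succ _ (j + 1), show A (j + 1) = 0 by simp [hA], zero_mul, zero_mul,
        add_zero, ← Finset.sum_add_distrib, ascPochhammer_succ_eval, ih, Finset.sum_mul]
      refine Finset.sum_congr rfl fun i _ => ?_
      rw [hd, hA]
      ring
    rw [hL, Finset.sum_range_succ' _ (j + 1), Finset.sum_range_succ' _ (j + 1), ← add_assoc,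
      ← Finset.sum_add_distrib]
    congr 1
    · refine Finset.sum_congr rfl fun i _ => ?_
      have h2 : ((j.choose (i + 1) : ℕ) : ℝ) * (i + 1) = j.choose i * (j - i) := by
        rcases le_or_gt i j with h | h
        · have := Nat.choose_succ_right_eq j i
          rw [← Nat.cast_sub h]
          exact_mod_cast this
        · rw [Nat.choose_eq_zero_of_lt h, Nat.choose_eq_zero_of_lt (by lia)]
          simp
      have h3 : ((j + 1).choose (i + 1) : ℝ) = j.choose i + j.choose (i + 1) := by
        exact_mod_cast Nat.choose_succ_succ j i
      simp only [hA, h3, ascPochhammer_succ_eval]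
      have := hp i
      have hi : s + (i : ℝ) ≠ 0 := by positivity
      push_cast
      field_simp
      linear_combination (ascPochhammer ℝ j).eval s * (k.descFactorial (i + 1) : ℝ) * h2
    · simp [hA, ascPochhammer_succ_eval]

theorem hasSum_pow_div_factorial_mul_descFactorial (z : ℝ) (i : ℕ) :
    HasSum (fun k : ℕ => z ^ k / (k.factorial : ℝ) * (k.descFactorial i : ℝ))
      (z ^ i * Real.exp z) := by
  have h := (hasSum_nat_add_iff (f := fun k : ℕ => z ^ k / (k.factorial : ℝ) *
    (k.descFactorial i : ℝ)) (g := z ^ i * Real.exp z) i).1 ?_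
  · rwa [Finset.sum_eq_zero, add_zero] at h
    intro k hk
    rw [Nat.descFactorial_of_lt (Finset.mem_range.1 hk)]
    simp
  · have h0 := (NormedSpace.expSeries_div_hasSum_exp z).mul_left (z ^ i)
    rw [← Real.exp_eq_exp_ℝ] at h0
    have e : (fun k : ℕ => z ^ (k + i) / ((k + i).factorial : ℝ) * ((k + i).descFactorial i : ℝ)) =
        fun k : ℕ => z ^ i * (z ^ k / (k.factorial : ℝ)) := funext fun k => by
      have h1 := Nat.factorial_mul_descFactorial (Nat.le_add_left i k)
      rw [Nat.add_sub_cancel] at h1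
      have h2 : (k.factorial : ℝ) * ((k + i).descFactorial i : ℝ) = ((k + i).factorial : ℝ) := by
        exact_mod_cast h1
      have h3 : (k.factorial : ℝ) ≠ 0 := by positivity
      have h4 : ((k + i).factorial : ℝ) ≠ 0 := by positivity
      field_simp
      rw [pow_add]
      linear_combination z ^ k * z ^ i * h2
    rw [e]
    exact h0

theorem hasSum_pow_div_factorial_mul_ascPochhammer {α : ℝ} (hα : -1 < α) (z : ℝ) (j : ℕ) :
    HasSum (fun k : ℕ => z ^ k / (k.factorial : ℝ) * (ascPochhammer ℝ j).eval (α + 1 + k))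
      (Real.exp z * ((j.factorial : ℝ) * (reflLaguerre α j).eval z)) := by
  have h := hasSum_sum (s := Finset.range (j + 1)) fun i _ =>
    (hasSum_pow_div_factorial_mul_descFactorial z i).mul_left ((j.choose i : ℝ) *
        ((ascPochhammer ℝ j).eval (α + 1) / (ascPochhammer ℝ i).eval (α + 1)))
  have e : (fun k : ℕ => z ^ k / (k.factorial : ℝ) * (ascPochhammer ℝ j).eval (α + 1 + k)) =
      fun k : ℕ => ∑ i ∈ Finset.range (j + 1), (j.choose i : ℝ) *
        ((ascPochhammer ℝ j).eval (α + 1) / (ascPochhammer ℝ i).eval (α + 1)) *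
          (z ^ k / (k.factorial : ℝ) * (k.descFactorial i : ℝ)) := funext fun k => by
    rw [ascPochhammer_eval_add_natCast (by linarith : 0 < α + 1), Finset.mul_sum]
    exact Finset.sum_congr rfl fun i _ => by ring
  have e' : Real.exp z * ((j.factorial : ℝ) * (reflLaguerre α j).eval z) =
      ∑ i ∈ Finset.range (j + 1), (j.choose i : ℝ) *
        ((ascPochhammer ℝ j).eval (α + 1) / (ascPochhammer ℝ i).eval (α + 1)) *
          (z ^ i * Real.exp z) := by
    rw [eval_eq_sum_range' (Nat.lt_succ_of_le (natDegree_reflLaguerre_le α j)), Finset.mul_sum,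
      Finset.mul_sum]
    refine Finset.sum_congr rfl fun i _ => ?_
    rw [coeff_reflLaguerre]
    have : (j.factorial : ℝ) ≠ 0 := by positivity
    field_simp
  rw [e, e']
  exact h

/-- The entire function `z ↦ ∑ k, z ^ k / (k! Γ(k + α + 1))`, which carries the power series part of
`J_α`. -/
def besselSeries (α z : ℝ) : ℝ :=
  ∑' k : ℕ, z ^ k / ((k.factorial : ℝ) * Real.Gamma (k + α + 1))

theorem gamma_natCast_add_pos {α : ℝ} (hα : -1 < α) (k : ℕ) : 0 < Real.Gamma (k + α + 1) :=
  Real.Gamma_pos_of_pos (by have : (0 : ℝ) ≤ k := by positivity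
                            linarith)

/-- A bound uniform in `k` lets the exponential series dominate the Bessel series. The minimum is
needed because `(α+1)_k` is `1` at `k = 0` but only at least `α + 1` afterwards. -/
theorem min_mul_gamma_le {α : ℝ} (hα : -1 < α) (k : ℕ) :
    min 1 (α + 1) * Real.Gamma (α + 1) ≤ Real.Gamma (k + α + 1) := by
  have h0 : 0 < α + 1 := by linarith
  rw [show (k : ℝ) + α + 1 = α + 1 + k by ring, gamma_add_natCast h0]
  refine mul_le_mul_of_nonneg_right ?_ (Real.Gamma_pos_of_pos h0).le
  cases k with
  | zero => simp
  | succ k =>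
    refine (min_le_right _ _).trans ?_
    induction k with
    | zero => simp
    | succ k ih =>
      rw [ascPochhammer_succ_eval]
      refine ih.trans (le_mul_of_one_le_right (ascPochhammer_eval_pos hα _).le ?_)
      have : (0 : ℝ) ≤ k := by positivity
      push_cast
      linarith

theorem summable_besselSeries {α : ℝ} (hα : -1 < α) (z : ℝ) :
    Summable fun k : ℕ => z ^ k / ((k.factorial : ℝ) * Real.Gamma (k + α + 1)) := by
  have h0 : 0 < α + 1 := by linarith
  have hm : 0 < min 1 (α + 1) * Real.Gamma (α + 1) :=
    mul_pos (lt_min one_pos h0) (Real.Gamma_pos_of_pos h0)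
  refine Summable.of_norm_bounded ((Real.summable_pow_div_factorial |z|).mul_right
    (min 1 (α + 1) * Real.Gamma (α + 1))⁻¹) fun k => ?_
  have hk := gamma_natCast_add_pos hα k
  rw [norm_div, norm_pow, Real.norm_eq_abs, Real.norm_of_nonneg (by positivity), ← div_div,
    ← div_eq_mul_inv]
  exact div_le_div_of_nonneg_left (by positivity) hm (min_mul_gamma_le hα k)

theorem measurable_besselSeries {α : ℝ} (hα : -1 < α) : Measurable (besselSeries α) := by
  refine measurable_of_tendsto_metrizable (f := fun n z => ∑ k ∈ Finset.range n,
    z ^ k / ((k.factorial : ℝ) * Real.Gamma (k + α + 1))) (fun n => by fun_prop) ?_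
  exact tendsto_pi_nhds.2 fun z => (summable_besselSeries hα z).hasSum.tendsto_sum_nat

theorem abs_besselSeries_le {α : ℝ} (hα : -1 < α) (z : ℝ) :
    |besselSeries α z| ≤ besselSeries α |z| := by
  have e : ∀ k : ℕ, ‖z ^ k / ((k.factorial : ℝ) * Real.Gamma (k + α + 1))‖ =
      |z| ^ k / ((k.factorial : ℝ) * Real.Gamma (k + α + 1)) := fun k => by
    have hk := gamma_natCast_add_pos hα k
    rw [norm_div, norm_pow, Real.norm_eq_abs, Real.norm_of_nonneg (by positivity)]
  have h := norm_tsum_le_tsum_norm (summable_besselSeries hα z).norm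
  simpa only [e] using! h

theorem besselJ_eq {α : ℝ} {t x : ℝ} (ht : 0 < t) (hx : x < 0) :
    besselJ α (2 * √(-(t * x))) = (t ^ (α / 2) * (-x) ^ (α / 2)) * besselSeries α (t * x) := by
  have hp : 0 < -(t * x) := by nlinarith
  rw [besselJ, besselSeries, ← tsum_mul_left]
  refine tsum_congr fun k => ?_
  rw [mul_div_cancel_left₀ _ (two_ne_zero), Real.sqrt_eq_rpow, ← Real.rpow_mul hp.le,
    show 1 / 2 * (2 * (k : ℝ) + α) = k + α / 2 by ring, Real.rpow_add hp, Real.rpow_natCast,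
    ← mul_neg, Real.mul_rpow ht.le (by linarith), mul_neg, neg_pow (t * x)]
  have h2 : ((-1 : ℝ) ^ k) * (-1) ^ k = 1 := by rw [← mul_pow]; simp
  linear_combination ((t * x) ^ k / ((k.factorial : ℝ) * Real.Gamma (k + α + 1)) *
    (t ^ (α / 2) * (-x) ^ (α / 2))) * h2

/-- Termwise integration yields `Γ(α+1+j+k) / Γ(k+α+1) = (α+1+k)_j`. The resulting series is a
Kummer-type transform of the polynomial, and the same series at `|x|` justifies the interchange. -/
theorem integral_exp_mul_besselSeries {α : ℝ} (hα : -1 < α) (x : ℝ) (j : ℕ) :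
    ∫ t in Set.Ioi (0 : ℝ), Real.exp (-t) * t ^ (α + j) * besselSeries α (t * x) =
      Real.exp x * ((j.factorial : ℝ) * (reflLaguerre α j).eval x) := by
  have h0 : 0 < α + 1 := by linarith
  have hs : ∀ k : ℕ, 0 < α + 1 + j + k := fun k => by positivity
  obtain ⟨F, hF⟩ : ∃ F : ℕ → ℝ → ℝ, F = fun (k : ℕ) (t : ℝ) =>
    x ^ k / ((k.factorial : ℝ) * Real.Gamma (k + α + 1)) *
      (Real.exp (-t) * t ^ (α + 1 + j + k - 1)) := ⟨_, rfl⟩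
  have hint : ∀ k, IntegrableOn (F k) (Set.Ioi 0) := fun k => by
    rw [hF]
    exact (Real.GammaIntegral_convergent (hs k)).const_mul _
  have hG : ∀ k : ℕ, Real.Gamma (α + 1 + j + k) =
      (ascPochhammer ℝ j).eval (α + 1 + k) * Real.Gamma (k + α + 1) := fun k => by
    rw [add_right_comm, gamma_add_natCast (by positivity), show α + 1 + (k : ℝ) = k + α + 1 by ring]
  have hval : ∀ k, ∫ t in Set.Ioi (0 : ℝ), F k t =
      x ^ k / (k.factorial : ℝ) * (ascPochhammer ℝ j).eval (α + 1 + k) := fun k => by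
    rw [hF]
    simp only
    rw [integral_const_mul, ← Real.Gamma_eq_integral (hs k), hG]
    have := (gamma_natCast_add_pos hα k).ne'
    field_simp
  have hnorm : ∀ k, ∫ t in Set.Ioi (0 : ℝ), ‖F k t‖ =
      |x| ^ k / (k.factorial : ℝ) * (ascPochhammer ℝ j).eval (α + 1 + k) := fun k => by
    have hk := gamma_natCast_add_pos hα k
    have e : Set.EqOn (fun t => ‖F k t‖)
        (fun t => |x| ^ k / ((k.factorial : ℝ) * Real.Gamma (k + α + 1)) *
          (Real.exp (-t) * t ^ (α + 1 + j + k - 1))) (Set.Ioi 0) := fun t ht => by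
      have ht' : 0 ≤ t ^ (α + 1 + j + k - 1) := Real.rpow_nonneg (le_of_lt ht) _
      simp only [hF]
      rw [norm_mul, norm_div, norm_pow, Real.norm_eq_abs, Real.norm_of_nonneg (by positivity),
        Real.norm_of_nonneg (by positivity)]
    rw [setIntegral_congr_fun measurableSet_Ioi e, integral_const_mul,
      ← Real.Gamma_eq_integral (hs k), hG]
    field_simp
  have h := hasSum_integral_of_summable_integral_norm hint (by
    simpa only [hnorm] using (hasSum_pow_div_factorial_mul_ascPochhammer hα |x| j).summable)
  simp only [hval] at h
  rw [(hasSum_pow_div_factorial_mul_ascPochhammer hα x j).unique h]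
  refine setIntegral_congr_fun measurableSet_Ioi fun t ht => ?_
  have ht' : (0 : ℝ) < t := ht
  simp only [besselSeries, hF]
  rw [← tsum_mul_left]
  refine tsum_congr fun k => ?_
  rw [show α + 1 + j + k - 1 = α + j + k by ring, Real.rpow_add ht' (α + j), Real.rpow_natCast,
    mul_pow]
  ring

theorem integrableOn_exp_mul_besselSeries {α : ℝ} (hα : -1 < α) (x : ℝ) (j : ℕ) :
    IntegrableOn (fun t : ℝ => Real.exp (-t) * t ^ (α + j) * besselSeries α (t * x))
      (Set.Ioi 0) := by
  have hpos : IntegrableOn (fun t : ℝ => Real.exp (-t) * t ^ (α + j) * besselSeries α (t * |x|))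
      (Set.Ioi 0) := by
    -- A non-integrable function has integral `0` by convention, while the computed value at `|x|`
    -- is positive.
    by_contra h
    have h1 := integral_undef h
    rw [integral_exp_mul_besselSeries hα] at h1
    have := eval_reflLaguerre_pos hα j (abs_nonneg x)
    exact absurd h1 (by positivity)
  refine Integrable.mono' hpos ?_ ?_
  · have := measurable_besselSeries hα
    exact Measurable.aestronglyMeasurable (by fun_prop)
  · filter_upwards [self_mem_ae_restrict measurableSet_Ioi] with t ht
    have ht' : (0 : ℝ) < t := ht
    have h1 := abs_besselSeries_le hα (t * x)
    rw [abs_mul t, abs_of_pos ht'] at h1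
    have h2 : 0 ≤ Real.exp (-t) * t ^ (α + j) := by positivity
    rw [norm_mul, Real.norm_of_nonneg h2]
    exact mul_le_mul_of_nonneg_left h1 h2

/-! ### The double integral -/

theorem hypergeometric_neg_natCast_one (n : ℕ) (θ : ℝ) :
    hypergeometric [-(n : ℝ), 1] [] (-1 / θ) =
      ∑ k ∈ Finset.range (n + 1), (n.descFactorial k : ℝ) * (θ⁻¹) ^ k := by
  unfold hypergeometric
  rw [tsum_eq_sum (s := Finset.range (n + 1))]
  · refine Finset.sum_congr rfl fun k _ => ?_
    have hk : (k.factorial : ℝ) ≠ 0 := by positivity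
    have h2 : ((-1 : ℝ) ^ k) * (-1) ^ k = 1 := by rw [← mul_pow]; simp
    simp only [List.map_cons, List.map_nil, List.prod_cons, List.prod_nil, mul_one, div_one]
    rw [ascPochhammer_eval_neg_natCast, ascPochhammer_eval_one, neg_div, one_div, neg_pow θ⁻¹]
    field_simp
    linear_combination (n.descFactorial k : ℝ) * θ⁻¹ ^ k * h2
  · intro k hk
    have h : n < k := by simpa [Nat.lt_succ_iff] using hk
    simp [ascPochhammer_eval_neg_coe_nat_of_lt h]

/-- Reversing the sum, `j = n - k`, turns `θ^(n+c-1-k)` into `θ^(j+c-1)`; as `c` is a positive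
integer, these are natural powers. -/
theorem rpow_mul_hypergeometric {c : ℕ} (hc : 0 < c) (n : ℕ) {θ : ℝ} (hθ : 0 < θ) :
    θ ^ ((n : ℝ) + c - 1) * hypergeometric [-(n : ℝ), 1] [] (-1 / θ) =
      ∑ j ∈ Finset.range (n + 1), (n.factorial : ℝ) / (j.factorial : ℝ) * θ ^ (j + (c - 1)) := by
  rw [hypergeometric_neg_natCast_one, ← Finset.sum_flip, Finset.mul_sum]
  refine Finset.sum_congr rfl fun j hj => ?_
  have hj' : j ≤ n := Nat.lt_succ_iff.1 (Finset.mem_range.1 hj)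
  have h1 : (n.descFactorial (n - j) : ℝ) = n.factorial / j.factorial := by
    rw [eq_div_iff (by positivity)]
    have := Nat.factorial_mul_descFactorial (Nat.sub_le n j)
    rw [Nat.sub_sub_self hj', mul_comm] at this
    exact_mod_cast this
  have h2 : (n : ℝ) + c - 1 = ((j + (c - 1) + (n - j) : ℕ) : ℝ) := by
    push_cast [Nat.cast_sub hj', Nat.cast_sub hc]
    ring
  rw [h1, h2, Real.rpow_natCast, pow_add θ _ (n - j), inv_pow]
  field_simp

theorem besselIntegrand_eqOn (α : ℝ) {c : ℕ} (hc : 0 < c) (n : ℕ) (x t : ℝ) :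
    Set.EqOn (besselIntegrand α c n x t)
      (fun θ => Real.exp (-t) * t ^ (α / 2 - c) * besselJ α (2 * √(-(t * x))) *
        ∑ j ∈ Finset.range (n + 1), (n.factorial : ℝ) / (j.factorial : ℝ) * θ ^ (j + (c - 1)))
      (Set.Ioi 0) := fun θ hθ => by
  simp only
  rw [← rpow_mul_hypergeometric hc n hθ, besselIntegrand]
  ring

theorem intervalIntegrable_besselIntegrand (α : ℝ) {c : ℕ} (hc : 0 < c) (n : ℕ) (x : ℝ) {t : ℝ}
    (ht : 0 < t) : IntervalIntegrable (besselIntegrand α c n x t) volume 0 t := by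
  refine IntervalIntegrable.congr (f := fun θ => Real.exp (-t) * t ^ (α / 2 - c) *
    besselJ α (2 * √(-(t * x))) * ∑ j ∈ Finset.range (n + 1),
      (n.factorial : ℝ) / (j.factorial : ℝ) * θ ^ (j + (c - 1))) ?_
    (Continuous.intervalIntegrable (by fun_prop) _ _)
  intro θ hθ
  rw [Set.uIoc_of_le ht.le] at hθ
  exact (besselIntegrand_eqOn α hc n x t hθ.1).symm

/-- The factor `1/(j+c)` comes from integrating `θ^(j+c-1)`. The resulting `t^(j+c)` absorbs
`t^(-c)`, and the two halves `t^(α/2)` combine to `t^α`. -/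
theorem integral_besselIntegrand {α : ℝ} {c : ℕ} (hc : 0 < c) (n : ℕ) {x t : ℝ} (hx : x < 0)
    (ht : 0 < t) :
    ∫ θ in (0 : ℝ)..t, besselIntegrand α c n x t θ =
      ∑ j ∈ Finset.range (n + 1), (n.factorial : ℝ) / ((j.factorial : ℝ) * lam j c) *
        (-x) ^ (α / 2) * (Real.exp (-t) * t ^ (α + j) * besselSeries α (t * x)) := by
  rw [intervalIntegral.integral_of_le ht.le, setIntegral_congr_fun measurableSet_Ioc
    ((besselIntegrand_eqOn α hc n x t).mono fun θ hθ => hθ.1), ← intervalIntegral.integral_of_le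
    ht.le, intervalIntegral.integral_const_mul, intervalIntegral.integral_finsetSum
    fun j _ => Continuous.intervalIntegrable (by fun_prop) _ _, Finset.mul_sum]
  refine Finset.sum_congr rfl fun j _ => ?_
  have hcast : ((j + (c - 1) : ℕ) : ℝ) + 1 = lam j c := by
    rw [lam]
    push_cast [Nat.cast_sub hc]
    ring
  have hl : lam j c ≠ 0 := (lam_pos (by exact_mod_cast hc) j).ne'
  have hr : t ^ (α + j) = t ^ (α / 2 - c) * t ^ (α / 2) * t ^ (j + (c - 1) + 1) := by
    rw [← Real.rpow_natCast, ← Real.rpow_add ht, ← Real.rpow_add ht, Nat.cast_succ, hcast, lam]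
    congr 1
    ring
  rw [intervalIntegral.integral_const_mul, integral_pow, hcast, besselJ_eq ht hx, hr]
  simp only [ne_eq, Nat.add_eq_zero_iff, one_ne_zero, and_false, not_false_eq_true, zero_pow,
    sub_zero]
  field_simp

theorem eval_modKernel_zero {α : ℝ} (hα : -1 < α) (c : ℝ) (n : ℕ) (x : ℝ) :
    (modKernel α c 0 n).eval x =
      ∑ j ∈ Finset.range (n + 1), 1 / lam j c * (1 / Real.Gamma (α + 1) *
        (reflLaguerre α j).eval x) := by
  rw [modKernel, eval_finsetSum]
  refine Finset.sum_congr rfl fun j _ => ?_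
  have h := congrArg (eval x) (eval_normLaguerre_zero_mul hα j)
  simp only [eval_mul, eval_C] at h ⊢
  rw [← h]
  ring

theorem modKernel_bessel_representation {α : ℝ} (hα : -1 < α) {c : ℕ} (hc : 0 < c) (n : ℕ) {x : ℝ}
    (hx : x < 0) :
    IntegrableOn (fun t : ℝ => ∫ θ in (0 : ℝ)..t, besselIntegrand α c n x t θ) (Set.Ioi 0) ∧
      (modKernel α c 0 n).eval x =
        1 / (Real.Gamma (α + 1) * (n.factorial : ℝ)) * Real.exp (-x) * (-x) ^ (-(α / 2)) *
          ∫ t in Set.Ioi (0 : ℝ), ∫ θ in (0 : ℝ)..t, besselIntegrand α c n x t θ := by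
  have e : Set.EqOn (fun t : ℝ => ∫ θ in (0 : ℝ)..t, besselIntegrand α c n x t θ)
      (fun t => ∑ j ∈ Finset.range (n + 1), (n.factorial : ℝ) / ((j.factorial : ℝ) * lam j c) *
        (-x) ^ (α / 2) * (Real.exp (-t) * t ^ (α + j) * besselSeries α (t * x))) (Set.Ioi 0) :=
    fun t ht => integral_besselIntegrand hc n hx ht
  have hI : ∀ j ∈ Finset.range (n + 1), IntegrableOn (fun t : ℝ =>
      (n.factorial : ℝ) / ((j.factorial : ℝ) * lam j c) *
        (-x) ^ (α / 2) * (Real.exp (-t) * t ^ (α + j) * besselSeries α (t * x))) (Set.Ioi 0) :=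
    fun j _ => (integrableOn_exp_mul_besselSeries hα x j).const_mul _
  refine ⟨IntegrableOn.congr_fun (integrable_finsetSum _ hI) e.symm measurableSet_Ioi, ?_⟩
  rw [setIntegral_congr_fun measurableSet_Ioi e, integral_finsetSum _ hI, eval_modKernel_zero hα,
    Finset.mul_sum]
  refine Finset.sum_congr rfl fun j _ => ?_
  rw [integral_const_mul, integral_exp_mul_besselSeries hα, Real.exp_neg,
    Real.rpow_neg (by linarith)]
  have h1 : 0 < (-x) ^ (α / 2) := Real.rpow_pos_of_pos (by linarith) _
  have h2 : 0 < Real.Gamma (α + 1) := Real.Gamma_pos_of_pos (by linarith)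
  have h3 : 0 < lam j c := lam_pos (by exact_mod_cast hc) j
  field_simp

end ModifiedKernel

end

open ModifiedKernel in
theorem theorem3 (α : ℝ) (hα : -1 < α) :
    (∀ c t₀ : ℝ, 0 < c → 0 ≤ t₀ →
      (∀ n : ℕ, (modKernel α c t₀ n).degree = n) ∧
      ∃ B : ℕ → ℝ, (∀ n, 0 < B n) ∧ ∀ n m : ℕ,
        IntegrableOn (sobolevIntegrand α c t₀ (modKernel α c t₀ n) (modKernel α c t₀ m))
          (Set.Iic 0) ∧
        ∫ x in Set.Iic (0 : ℝ),
          sobolevIntegrand α c t₀ (modKernel α c t₀ n) (modKernel α c t₀ m) x =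
            if n = m then B n else 0) ∧
    (∀ c : ℝ, 0 < c → ∀ n : ℕ,
      diffOp (α + 1) 0 (diffOp α c (modKernel α c 0 n)) =
        lam n 0 • diffOp α c (modKernel α c 0 n)) ∧
    (∀ c : ℕ, 0 < c → ∀ (n : ℕ) (x : ℝ), x < 0 →
      (∀ t : ℝ, 0 < t →
        IntervalIntegrable (besselIntegrand α c n x t) volume 0 t) ∧
      IntegrableOn (fun t : ℝ => ∫ θ in (0 : ℝ)..t, besselIntegrand α c n x t θ) (Set.Ioi 0) ∧
      (modKernel α c 0 n).eval x =
        1 / (Real.Gamma (α + 1) * (n.factorial : ℝ)) * Real.exp (-x) * (-x) ^ (-(α / 2)) *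
          ∫ t in Set.Ioi (0 : ℝ), ∫ θ in (0 : ℝ)..t, besselIntegrand α c n x t θ) :=
  ⟨fun _ _ hc ht => ⟨degree_modKernel hα hc ht, sobolev_orthogonality hα hc ht⟩,
    fun _ hc n => diffOp_diffOp_modKernel hα hc n,
    fun _ hc n x hx => ⟨fun _ ht => intervalIntegrable_besselIntegrand α hc n x ht,
      modKernel_bessel_representation hα hc n hx⟩⟩
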